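/- Let $p$ be a prime. For $a\in\mathbb Q$ and an integer $n\ge 0$ let $(a)_n=\prod_{k=0}^{n-1}(a+k)$ (with $(a)_0=1$). For rational numbers $a,b$ and $k\ge 1$, write $a\equiv b\pmod{p^k}$ if $a-b=p^k c$ for some rational number $c$ whose denominator in lowest terms is not divisible by $p$. Then the following supercongruences hold. (J1) If $p>2$, then for both $N=\frac{p-1}{2}$ and $N=p-1$, $$\sum_{n=0}^{N}\frac{(\frac12)_n^3}{n!^3}\,(3n+1)\,2^{2n}\equiv p\pmod{p^3}.$$ (J2) If $p>3$, then for both $N=\frac{p-1}{2}$ and $N=p-1$, $$\sum_{n=0}^{N}\frac{(\frac12)_n^5}{n!^5}\,(10n^2+6n+1)\,(-1)^n2^{2n}\equiv p^2\pmod{p^5}.$$ (J4) If $p>2$, then $$\sum_{n=0}^{p-1}\frac{(\frac12)_n^3}{n!^3}\,(3n+1)\,(-1)^n2^{3n}\equiv(-1)^{(p-1)/2}\,p\pmod{p^3}.$$ -/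

import Mathlib

/-- Congruence of rational numbers modulo `p ^ k`: the difference is `p ^ k` times a rational
number whose denominator is not divisible by `p` (a `p`-integral rational number). -/
def RatModEq (p k : ℕ) (a b : ℚ) : Prop :=
  ∃ c : ℚ, ¬ p ∣ c.den ∧ a - b = (p : ℚ) ^ k * c

/-- The Pochhammer symbol `(a)_n = a (a + 1) ⋯ (a + n - 1)`, with `(a)_0 = 1`. -/
noncomputable def poch (a : ℚ) (n : ℕ) : ℚ := (ascPochhammer ℚ n).eval a

open Polynomial

/-! ### Translation-invariant polynomials over `𝔽_p` -/

/-! Write p = 2m + 1. For (J1), put F(t) = ∑_{n ≤ m} (t)_n² (3n + 2t) a_n with a_n = C(2n,n)/n!².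
Since (1/2)_n 4^n = C(2n,n) n!, the sum up to m is F(1/2). The recurrence of a_n gives F(t+1) - F(t)
= (t+1)_m² a_m (4m+2), where 4m + 2 = 2p. For t = 1/2 + k with k < m, the product (t+1)_m contains
the factor p/2, so F(1/2) ≡ F(p/2) mod p³. At t = p/2 the term n = 0 is p, and the remaining terms
are t² ∑ 3 C(2n,n)/n mod p³. That last sum is 0 mod p because it is the coefficient of X² in F over
𝔽_p: there F is invariant under X ↦ X + 1 and of degree at most p, hence of the form c + c'(X^p -
X).

(J2) runs in the same way with (t)_n⁴, degree at most 2p and the coefficient of X⁴. The terms with m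
< n < p contain a power of p/2 and are negligible.

(J4) rests on a terminating series S(u, s, r) with 2u = s + r, evaluated by a contiguous relation.
Take u = x, s = x - y, r = x + y. The terms depend only on x and y², so the mixed difference over x
∈ {0, -p/2}, y ∈ {0, p} is divisible by p · p². Both values at x = -p/2 vanish, and x = 0, y = p
gives (-1)^m p, which determines the required value at x = y = 0 mod p³. The carrying lemmas are
`coeff_eq_zero_of_comp_X_add_one`, the two `sum_rising_…_telescope` identities,
`sum_strangeTerm_telescope` and `strangeTerm_mem_mixedDifference`. -/

/-- An invariant P takes the value P(0) on all of 𝔽_p, so X^p - X divides P - P(0). As X^p - X is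
itself invariant, so is the quotient. -/
theorem exists_eq_C_add_of_comp_X_add_one {p : ℕ} [Fact p.Prime] {P : (ZMod p)[X]}
    (h : P.comp (X + 1) = P) :
    ∃ R : (ZMod p)[X], R.comp (X + 1) = R ∧ P = C (P.coeff 0) + (X ^ p - X) * R := by
  have hp1 : 1 < p := (Fact.out : p.Prime).one_lt
  have hne : (X ^ p - X : (ZMod p)[X]) ≠ 0 := FiniteField.X_pow_card_sub_X_ne_zero _ hp1
  have hmon : (X ^ p - X : (ZMod p)[X]).Monic := by
    apply monic_X_pow_sub
    rw [degree_X]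
    exact_mod_cast hp1
  have hev : ∀ k : ℕ, P.eval (k : ZMod p) = P.coeff 0 := by
    intro k
    induction k with
    | zero => simp [coeff_zero_eq_eval_zero]
    | succ k ih =>
      rw [← ih]
      conv_rhs => rw [← h]
      simp
  have hdvd : (X ^ p - X : (ZMod p)[X]) ∣ P - C (P.coeff 0) := by
    rw [← modByMonic_eq_zero_iff_dvd hmon]
    refine eq_zero_of_natDegree_lt_card_of_eval_eq_zero' _ (Finset.univ : Finset (ZMod p)) ?_ ?_
    · intro a _
      have hdiv := modByMonic_add_div (P - C (P.coeff 0)) (X ^ p - X : (ZMod p)[X])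
      have := congrArg (eval a) hdiv
      have ha := hev a.val
      rw [ZMod.natCast_zmod_val] at ha
      simpa [ha, ZMod.pow_card] using this
    · rw [Finset.card_univ, ZMod.card]
      have := natDegree_modByMonic_lt (P - C (P.coeff 0)) hmon (by
        intro h1
        have h2 := FiniteField.X_pow_card_sub_X_natDegree_eq (ZMod p) hp1
        rw [h1] at h2
        simp at h2
        omega)
      rwa [FiniteField.X_pow_card_sub_X_natDegree_eq _ hp1] at this
  obtain ⟨R, hR⟩ := hdvd
  refine ⟨R, ?_, by rw [← hR]; ring⟩
  have h1 := congrArg (fun Q => Q.comp (X + 1 : (ZMod p)[X])) hR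
  simp only [sub_comp, h, C_comp, mul_comp, X_pow_comp, X_comp] at h1
  rw [hR, add_pow_char, one_pow, add_sub_add_right_eq_sub] at h1
  exact (mul_left_cancel₀ hne h1).symm

/-- P is in effect a polynomial of degree at most d in X^p - X, and below degree p only the powers
of -X are visible. -/
theorem coeff_eq_zero_of_comp_X_add_one {p : ℕ} [Fact p.Prime] {P : (ZMod p)[X]}
    (h : P.comp (X + 1) = P) {d k : ℕ} (hd : P.natDegree ≤ d * p) (hdk : d < k) (hk : k < p) :
    P.coeff k = 0 := by
  have hp1 : 1 < p := (Fact.out : p.Prime).one_lt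
  induction d generalizing P k with
  | zero => exact coeff_eq_zero_of_natDegree_lt (by omega)
  | succ d ih =>
    obtain ⟨R, hR, hP⟩ := exists_eq_C_add_of_comp_X_add_one h
    obtain ⟨k, rfl⟩ : ∃ j, k = j + 1 := ⟨k - 1, by omega⟩
    have hRd : R.natDegree ≤ d * p := by
      by_cases hR0 : R = 0
      · simp [hR0]
      have hdeg : ((X ^ p - X) * R).natDegree = p + R.natDegree := by
        rw [natDegree_mul (FiniteField.X_pow_card_sub_X_ne_zero _ hp1) hR0,
          FiniteField.X_pow_card_sub_X_natDegree_eq _ hp1]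
      have hPd : P.natDegree = p + R.natDegree := by
        rw [hP, natDegree_C_add, hdeg]
      rw [hPd, add_mul, one_mul] at hd
      omega
    -- Below degree p the factor X^p - X acts as -X, so a coefficient of P is minus the preceding
    -- one of R.
    rw [hP, coeff_add, sub_mul, coeff_sub, coeff_X_mul, coeff_X_pow_mul', if_neg (by omega),
      ih hR hRd (by omega) (by omega), coeff_C, if_neg (by omega)]
    simp

/-! ### Telescoping identities in commutative rings -/

/-- The rising factorial `t (t + 1) ⋯ (t + n - 1)` in a commutative ring. -/
def rising {R : Type*} [CommRing R] (t : R) (n : ℕ) : R := ∏ j ∈ Finset.range n, (t + j)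

section Rising

variable {R : Type*} [CommRing R]

@[simp] theorem rising_zero (t : R) : rising t 0 = 1 := by simp [rising]

theorem rising_succ (t : R) (n : ℕ) : rising t (n + 1) = rising t n * (t + n) := by
  simp [rising, Finset.prod_range_succ]

theorem rising_succ_left (t : R) (n : ℕ) : rising t (n + 1) = t * rising (t + 1) n := by
  rw [rising, Finset.prod_range_succ', rising, mul_comm]
  simp [add_assoc, add_comm (1 : R)]

theorem rising_one (n : ℕ) : rising (1 : R) n = n.factorial := by
  induction n with
  | zero => simp
  | succ n ih => rw [rising_succ, ih, Nat.factorial_succ]; push_cast; ring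

theorem map_rising {S : Type*} [CommRing S] (f : R →+* S) (t : R) (n : ℕ) :
    f (rising t n) = rising (f t) n := by
  simp [rising]

/-- The sequence `a` enters only through its recurrence, so the identity serves both over ℚ and over
𝔽_p[X]. The recurrence turns the boundary term at N into a multiple of a (N + 1), after which the
induction step is a polynomial identity. -/
theorem sum_rising_sq_telescope (t : R) (a : ℕ → R) (N : ℕ)
    (ha : ∀ n < N, a (n + 1) * (n + 1) ^ 3 = a n * (4 * n + 2)) :
    ∑ n ∈ Finset.range (N + 1), rising (t + 1) n ^ 2 * (3 * n + 2 * (t + 1)) * a n -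
      ∑ n ∈ Finset.range (N + 1), rising t n ^ 2 * (3 * n + 2 * t) * a n =
    rising (t + 1) N ^ 2 * (a N * (4 * N + 2)) := by
  induction N with
  | zero => simp; ring
  | succ N ih =>
    have h1 := ih fun n hn => ha n (by omega)
    rw [← ha N (by omega)] at h1
    rw [Finset.sum_range_succ _ (N + 1), Finset.sum_range_succ _ (N + 1), add_sub_add_comm, h1,
      rising_succ_left t, rising_succ (t + 1)]
    push_cast
    ring

theorem sum_rising_pow_four_telescope (t : R) (a : ℕ → R) (N : ℕ)
    (ha : ∀ n < N, a (n + 1) * (n + 1) ^ 5 = -(a n * (4 * n + 2))) :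
    ∑ n ∈ Finset.range (N + 1),
        rising (t + 1) n ^ 4 * (10 * n ^ 2 + 12 * (t + 1) * n + 4 * (t + 1) ^ 2) * a n -
      ∑ n ∈ Finset.range (N + 1), rising t n ^ 4 * (10 * n ^ 2 + 12 * t * n + 4 * t ^ 2) * a n =
    2 * rising (t + 1) N ^ 4 * (N + 1 + 2 * t) * (a N * (4 * N + 2)) := by
  induction N with
  | zero => simp; ring
  | succ N ih =>
    have h1 := ih fun n hn => ha n (by omega)
    rw [← neg_eq_iff_eq_neg.mpr (ha N (by omega))] at h1
    rw [Finset.sum_range_succ _ (N + 1), Finset.sum_range_succ _ (N + 1), add_sub_add_comm, h1,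
      rising_succ_left t, rising_succ (t + 1)]
    push_cast
    ring

end Rising

/-! ### Congruences for central binomial sums -/

theorem natDegree_rising_X_le {K : Type*} [Field K] (n : ℕ) :
    (rising (X : K[X]) n).natDegree ≤ n := by
  refine (natDegree_prod_le _ _).trans ?_
  refine (Finset.sum_le_card_nsmul _ _ 1 fun j _ => ?_).trans (by simp)
  rw [← C_eq_natCast, natDegree_X_add_C]

theorem rising_X_comp {K : Type*} [Field K] (n : ℕ) :
    (rising (X : K[X]) n).comp (X + 1) = rising (X + 1) n := by
  have := map_rising (compRingHom (X + 1 : K[X])) X n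
  rwa [coe_compRingHom_apply, coe_compRingHom_apply, X_comp] at this

theorem coeff_zero_rising_X_add_one {K : Type*} [Field K] (n : ℕ) :
    (rising (X + 1 : K[X]) n).coeff 0 = n.factorial := by
  have := map_rising (evalRingHom (0 : K)) (X + 1) n
  rw [coe_evalRingHom] at this
  rw [coeff_zero_eq_eval_zero, this]
  simp [rising_one]

theorem natCast_ne_zero_of_lt {p n : ℕ} (h0 : n ≠ 0) (h : n < p) : (n : ZMod p) ≠ 0 := by
  rw [Ne, ZMod.natCast_eq_zero_iff]
  exact fun hd => absurd (Nat.le_of_dvd (by omega) hd) (by omega)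

theorem factorial_ne_zero_of_lt {p n : ℕ} [hp : Fact p.Prime] (h : n < p) :
    (n.factorial : ZMod p) ≠ 0 := by
  rw [Ne, ZMod.natCast_eq_zero_iff, hp.out.dvd_factorial]
  omega

theorem four_mul_add_two_eq_zero {p m : ℕ} (hm : p = 2 * m + 1) :
    (4 * (m : (ZMod p)[X]) + 2) = 0 := by
  have h : ((2 * (2 * m + 1) : ℕ) : (ZMod p)[X]) = 0 := by
    rw [← hm]
    simp
  push_cast at h
  linear_combination h

/-- This is the coefficient of X² in the reduction of F mod p, where the boundary term of the
telescoping is 0 because 4m + 2 = 2p. -/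
theorem sum_centralBinom_div_eq_zero {p : ℕ} [hp : Fact p.Prime] {m : ℕ} (hm : p = 2 * m + 1) :
    ∑ n ∈ Finset.range m,
      (3 * (n + 1).centralBinom / ((n + 1 : ℕ) : ZMod p) : ZMod p) = 0 := by
  have hp2 := hp.out.two_le
  set a : ℕ → ZMod p := fun n => n.centralBinom / (n.factorial : ZMod p) ^ 2 with ha_def
  have ha : ∀ n < m, a (n + 1) * (n + 1) ^ 3 = a n * (4 * n + 2) := by
    intro n hn
    have h1 := natCast_ne_zero_of_lt (p := p) (n := n + 1) (by omega) (by omega)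
    have h2 := factorial_ne_zero_of_lt (p := p) (n := n) (by omega)
    have h3 : ((n + 1 : ℕ) : ZMod p) * (n + 1).centralBinom = 2 * (2 * n + 1) * n.centralBinom := by
      exact_mod_cast congrArg (Nat.cast : ℕ → ZMod p) (Nat.succ_mul_centralBinom_succ n)
    simp only [ha_def, Nat.factorial_succ]
    push_cast at h1 h3 ⊢
    field_simp
    linear_combination h3
  set P : (ZMod p)[X] :=
    ∑ n ∈ Finset.range (m + 1), rising X n ^ 2 * (3 * (n : (ZMod p)[X]) + 2 * X) * C (a n) with hP
  have hcomp : P.comp (X + 1) = P := by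
    have h1 := sum_rising_sq_telescope (X : (ZMod p)[X]) (fun n => C (a n)) m fun n hn => by
      simpa only [map_mul, map_pow, map_add, map_neg, map_natCast, map_ofNat, map_one] using
        congrArg C (ha n hn)
    rw [four_mul_add_two_eq_zero hm, mul_zero, mul_zero, sub_eq_zero] at h1
    have h3 := map_sum (compRingHom (X + 1 : (ZMod p)[X]))
      (fun n : ℕ => rising X n ^ 2 * (3 * (n : (ZMod p)[X]) + 2 * X) * C (a n))
      (Finset.range (m + 1))
    rw [coe_compRingHom_apply, ← hP] at h3
    rw [h3, hP, ← h1]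
    refine Finset.sum_congr rfl fun n _ => ?_
    simp [rising_X_comp]
  have hdeg : P.natDegree ≤ 1 * p := by
    refine natDegree_sum_le_of_forall_le _ _ fun n hn => ?_
    have hn' := Finset.mem_range.mp hn
    have h1 : (3 * (n : (ZMod p)[X]) + 2 * X).natDegree ≤ 1 := by
      compute_degree
    refine (natDegree_mul_C_le _ _).trans (natDegree_mul_le.trans ?_)
    have h2 := natDegree_pow_le_of_le 2 (natDegree_rising_X_le (K := ZMod p) n)
    omega
  rcases Nat.lt_or_ge p 3 with h | h
  · have : m = 0 := by omega
    simp [this]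
  have key := coeff_eq_zero_of_comp_X_add_one hcomp hdeg (k := 2) (by omega) (by omega)
  rw [hP, finsetSum_coeff, Finset.sum_range_succ'] at key
  rw [← key]
  have h0 : (rising X 0 ^ 2 * (3 * ((0 : ℕ) : (ZMod p)[X]) + 2 * X) * C (a 0)).coeff 2 = 0 := by
    simp [coeff_X]
  rw [h0, add_zero]
  refine Finset.sum_congr rfl fun n hn => ?_
  have hn' := Finset.mem_range.mp hn
  -- Each term with positive index is X² times a polynomial, so its coefficient of X² is the
  -- constant term of the cofactor.
  have e : rising X (n + 1) ^ 2 * (3 * ((n + 1 : ℕ) : (ZMod p)[X]) + 2 * X) * C (a (n + 1)) =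
      X ^ 2 * (rising (X + 1) n ^ 2 * (C (3 * ((n + 1 : ℕ) : ZMod p)) + C 2 * X) *
        C (a (n + 1))) := by
    rw [rising_succ_left]
    simp only [map_mul, map_natCast, map_ofNat]
    ring
  rw [e, coeff_X_pow_mul' , if_pos le_rfl, Nat.sub_self, mul_coeff_zero, mul_coeff_zero,
    coeff_add, coeff_C_zero, coeff_C_zero, coeff_mul_X_zero, pow_two, mul_coeff_zero,
    coeff_zero_rising_X_add_one]
  have h1 := natCast_ne_zero_of_lt (p := p) (n := n + 1) (by omega) (by omega)
  have h2 := factorial_ne_zero_of_lt (p := p) (n := n) (by omega)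
  simp only [ha_def, Nat.factorial_succ, Nat.cast_mul]
  field_simp
  ring

/-- Now the degree is at most 4m + 2 = 2p, so the coefficient of X⁴ vanishes as soon as 4 < p; the
term n = 0 is 4X² and does not contribute. -/
theorem sum_neg_one_pow_centralBinom_div_sq_eq_zero {p : ℕ} [hp : Fact p.Prime] {m : ℕ}
    (hm : p = 2 * m + 1) (hp3 : 3 < p) :
    ∑ n ∈ Finset.range m,
      (10 * ((-1) ^ (n + 1) * (n + 1).centralBinom) / ((n + 1 : ℕ) : ZMod p) ^ 2 : ZMod p) = 0 := by
  have hp5 : 4 < p := by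
    rcases Nat.lt_or_ge 4 p with h | h
    · exact h
    · omega
  set a : ℕ → ZMod p := fun n => (-1) ^ n * n.centralBinom / (n.factorial : ZMod p) ^ 4 with ha_def
  have ha : ∀ n < m, a (n + 1) * (n + 1) ^ 5 = -(a n * (4 * n + 2)) := by
    intro n hn
    have h1 := natCast_ne_zero_of_lt (p := p) (n := n + 1) (by omega) (by omega)
    have h2 := factorial_ne_zero_of_lt (p := p) (n := n) (by omega)
    have h3 : ((n + 1 : ℕ) : ZMod p) * (n + 1).centralBinom = 2 * (2 * n + 1) * n.centralBinom := by
      exact_mod_cast congrArg (Nat.cast : ℕ → ZMod p) (Nat.succ_mul_centralBinom_succ n)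
    simp only [ha_def, Nat.factorial_succ, pow_succ (-1 : ZMod p) n]
    push_cast at h1 h3 ⊢
    field_simp
    linear_combination (-1) * h3
  set P : (ZMod p)[X] := ∑ n ∈ Finset.range (m + 1),
    rising X n ^ 4 * (10 * (n : (ZMod p)[X]) ^ 2 + 12 * X * (n : (ZMod p)[X]) + 4 * X ^ 2) *
      C (a n) with hP
  have hcomp : P.comp (X + 1) = P := by
    have h1 := sum_rising_pow_four_telescope (X : (ZMod p)[X]) (fun n => C (a n)) m fun n hn => by
      simpa only [map_mul, map_pow, map_add, map_neg, map_natCast, map_ofNat, map_one] using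
        congrArg C (ha n hn)
    rw [four_mul_add_two_eq_zero hm, mul_zero, mul_zero, sub_eq_zero] at h1
    have h3 := map_sum (compRingHom (X + 1 : (ZMod p)[X]))
      (fun n : ℕ => rising X n ^ 4 *
        (10 * (n : (ZMod p)[X]) ^ 2 + 12 * X * (n : (ZMod p)[X]) + 4 * X ^ 2) * C (a n))
      (Finset.range (m + 1))
    rw [coe_compRingHom_apply, ← hP] at h3
    rw [h3, hP, ← h1]
    refine Finset.sum_congr rfl fun n _ => ?_
    simp [rising_X_comp]
  have hdeg : P.natDegree ≤ 2 * p := by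
    refine natDegree_sum_le_of_forall_le _ _ fun n hn => ?_
    have hn' := Finset.mem_range.mp hn
    have h1 : (10 * (n : (ZMod p)[X]) ^ 2 + 12 * X * (n : (ZMod p)[X]) + 4 * X ^ 2).natDegree ≤ 2 := by
      compute_degree
    refine (natDegree_mul_C_le _ _).trans (natDegree_mul_le.trans ?_)
    have h2 := natDegree_pow_le_of_le 4 (natDegree_rising_X_le (K := ZMod p) n)
    omega
  have key := coeff_eq_zero_of_comp_X_add_one hcomp hdeg (k := 4) (by omega) (by omega)
  rw [hP, finsetSum_coeff, Finset.sum_range_succ'] at key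
  rw [← key]
  have h0 : (rising X 0 ^ 4 * (10 * ((0 : ℕ) : (ZMod p)[X]) ^ 2 + 12 * X * ((0 : ℕ) : (ZMod p)[X]) +
      4 * X ^ 2) * C (a 0)).coeff 4 = 0 := by
    have : (4 : (ZMod p)[X]) = C 4 := (map_ofNat C 4).symm
    simp only [rising_zero, one_pow, Nat.cast_zero, this, one_mul, mul_zero, zero_add, ne_eq,
      OfNat.ofNat_ne_zero, not_false_eq_true, zero_pow, coeff_mul_C, coeff_C_mul, coeff_X_pow]
    simp
  rw [h0, add_zero]
  refine Finset.sum_congr rfl fun n hn => ?_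
  have hn' := Finset.mem_range.mp hn
  have e : rising X (n + 1) ^ 4 * (10 * ((n + 1 : ℕ) : (ZMod p)[X]) ^ 2 +
        12 * X * ((n + 1 : ℕ) : (ZMod p)[X]) + 4 * X ^ 2) * C (a (n + 1)) =
      X ^ 4 * ((rising (X + 1) n * rising (X + 1) n) * (rising (X + 1) n * rising (X + 1) n) *
        (C (10 * ((n + 1 : ℕ) : ZMod p) ^ 2) +
          (12 * ((n + 1 : ℕ) : (ZMod p)[X]) + 4 * X) * X) * C (a (n + 1))) := by
    rw [rising_succ_left]
    simp only [map_mul, map_pow, map_natCast, map_ofNat]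
    ring
  rw [e, coeff_X_pow_mul', if_pos le_rfl, Nat.sub_self, mul_coeff_zero, mul_coeff_zero,
    coeff_add, coeff_C_zero, coeff_C_zero, coeff_mul_X_zero, mul_coeff_zero, mul_coeff_zero,
    coeff_zero_rising_X_add_one]
  have h1 := natCast_ne_zero_of_lt (p := p) (n := n + 1) (by omega) (by omega)
  have h2 := factorial_ne_zero_of_lt (p := p) (n := n) (by omega)
  simp only [ha_def, Nat.factorial_succ, Nat.cast_mul]
  field_simp
  ring

/-! ### `p`-integral rationals -/

/-- The ring of rational numbers whose denominator is not divisible by `p`. -/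
def pIntegral (p : ℕ) [hp : Fact p.Prime] : Subring ℚ where
  carrier := {x | ¬ p ∣ x.den}
  mul_mem' {a b} ha hb h := by
    rcases hp.out.dvd_mul.mp (h.trans (Rat.mul_den_dvd a b)) with h | h
    exacts [ha h, hb h]
  one_mem' := by simpa using hp.out.one_lt.ne'
  add_mem' {a b} ha hb h := by
    rcases hp.out.dvd_mul.mp (h.trans (Rat.add_den_dvd a b)) with h | h
    exacts [ha h, hb h]
  zero_mem' := by simpa using hp.out.one_lt.ne'
  neg_mem' {a} ha := by simpa using ha

/-- The multiples of `p ^ k` in the ring of `p`-integral rationals. -/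
def pMultiples (p : ℕ) [Fact p.Prime] (k : ℕ) : AddSubgroup ℚ where
  carrier := {x | ∃ c ∈ pIntegral p, x = (p : ℚ) ^ k * c}
  add_mem' := by
    rintro _ _ ⟨c, hc, rfl⟩ ⟨d, hd, rfl⟩
    exact ⟨c + d, add_mem hc hd, by ring⟩
  zero_mem' := ⟨0, zero_mem _, by ring⟩
  neg_mem' := by
    rintro _ ⟨c, hc, rfl⟩
    exact ⟨-c, neg_mem hc, by ring⟩

section PIntegral

variable {p : ℕ} [hp : Fact p.Prime]

theorem ratModEq_iff {k : ℕ} {a b : ℚ} : RatModEq p k a b ↔ a - b ∈ pMultiples p k := Iff.rfl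

theorem mem_pIntegral_iff_den_cast_ne_zero {x : ℚ} :
    x ∈ pIntegral p ↔ (x.den : ZMod p) ≠ 0 := by
  rw [Ne, ZMod.natCast_eq_zero_iff]
  rfl

theorem inv_intCast_mem_pIntegral {n : ℤ} (h : ¬ (p : ℤ) ∣ n) : (n : ℚ)⁻¹ ∈ pIntegral p := by
  change ¬ p ∣ (n : ℚ)⁻¹.den
  rw [Rat.inv_intCast_den, if_neg (by rintro rfl; simp at h)]
  rwa [Int.natCast_dvd] at h

theorem inv_natCast_mem_pIntegral {n : ℕ} (h : ¬ p ∣ n) : (n : ℚ)⁻¹ ∈ pIntegral p := by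
  have := inv_intCast_mem_pIntegral (p := p) (n := n) (by exact_mod_cast h)
  simpa using this

theorem inv_factorial_mem_pIntegral {n : ℕ} (h : n < p) : (n.factorial : ℚ)⁻¹ ∈ pIntegral p :=
  inv_natCast_mem_pIntegral (by rw [hp.out.dvd_factorial]; omega)

theorem inv_natCast_mem_pIntegral_of_lt {n : ℕ} (h0 : n ≠ 0) (h : n < p) :
    (n : ℚ)⁻¹ ∈ pIntegral p :=
  inv_natCast_mem_pIntegral fun hd => absurd (Nat.le_of_dvd (by omega) hd) (by omega)

theorem inv_two_mem_pIntegral (h : 2 < p) : (2 : ℚ)⁻¹ ∈ pIntegral p :=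
  inv_natCast_mem_pIntegral_of_lt (n := 2) (by omega) h

theorem inv_one_add_mem_pIntegral {x : ℚ} (hx : x ∈ pIntegral p) :
    (1 + p * x)⁻¹ ∈ pIntegral p := by
  have hd : (x.den : ℚ) ≠ 0 := by simp
  have e : (1 + p * x)⁻¹ = x.den * (((x.den + p * x.num : ℤ) : ℚ))⁻¹ := by
    rw [show 1 + (p : ℚ) * x = ((x.den + p * x.num : ℤ) : ℚ) / x.den by
      push_cast; rw [add_div, div_self hd, mul_div_assoc, Rat.num_div_den]]
    rw [inv_div, div_eq_mul_inv]
  rw [e]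
  refine mul_mem (natCast_mem _ _) (inv_intCast_mem_pIntegral fun h => hx ?_)
  have := (Int.dvd_add_left (dvd_mul_right (p : ℤ) x.num)).mp h
  exact_mod_cast this

theorem inv_add_mem_pIntegral {x y : ℚ} (hx : x⁻¹ ∈ pIntegral p) (hx0 : x ≠ 0)
    (hy : y ∈ pIntegral p) : (x + p * y)⁻¹ ∈ pIntegral p := by
  have e : x + p * y = x * (1 + p * (x⁻¹ * y)) := by field_simp
  rw [e, mul_inv]
  exact mul_mem hx (inv_one_add_mem_pIntegral (mul_mem hx hy))

theorem mul_mem_pMultiples {k : ℕ} {x y : ℚ} (hx : x ∈ pIntegral p) (hy : y ∈ pMultiples p k) :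
    x * y ∈ pMultiples p k := by
  obtain ⟨c, hc, rfl⟩ := hy
  exact ⟨x * c, mul_mem hx hc, by ring⟩

theorem mul_mem_pMultiples_add {j k : ℕ} {x y : ℚ} (hx : x ∈ pMultiples p j)
    (hy : y ∈ pMultiples p k) : x * y ∈ pMultiples p (j + k) := by
  obtain ⟨c, hc, rfl⟩ := hx
  obtain ⟨d, hd, rfl⟩ := hy
  exact ⟨c * d, mul_mem hc hd, by ring⟩

theorem pow_mem_pMultiples {x : ℚ} (hx : x ∈ pMultiples p 1) (k : ℕ) :
    x ^ k ∈ pMultiples p k := by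
  obtain ⟨c, hc, rfl⟩ := hx
  exact ⟨c ^ k, pow_mem hc k, by ring⟩

theorem mem_pIntegral_of_mem_pMultiples {k : ℕ} {x : ℚ} (hx : x ∈ pMultiples p k) :
    x ∈ pIntegral p := by
  obtain ⟨c, hc, rfl⟩ := hx
  exact mul_mem (pow_mem (natCast_mem _ _) _) hc

theorem pow_sub_pow_mem_pMultiples {x y : ℚ} {k : ℕ} (hx : x ∈ pIntegral p) (hy : y ∈ pIntegral p)
    (h : x - y ∈ pMultiples p k) (n : ℕ) : x ^ n - y ^ n ∈ pMultiples p k := by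
  induction n with
  | zero => simp [zero_mem]
  | succ n ih =>
    have e : x ^ (n + 1) - y ^ (n + 1) = x * (x ^ n - y ^ n) + y ^ n * (x - y) := by ring
    rw [e]
    exact add_mem (mul_mem_pMultiples hx ih) (mul_mem_pMultiples (pow_mem hy n) h)

/-- The cast ℚ → `ZMod p` is additive only where denominators are prime to p, hence the integrality
hypothesis. -/
theorem cast_sum_of_mem_pIntegral {ι : Type*} (s : Finset ι) (f : ι → ℚ)
    (hf : ∀ i ∈ s, f i ∈ pIntegral p) :
    ((∑ i ∈ s, f i : ℚ) : ZMod p) = ∑ i ∈ s, (f i : ZMod p) := by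
  classical
  induction s using Finset.induction_on with
  | empty => simp
  | insert a s ha ih =>
    have h1 := hf a (Finset.mem_insert_self a s)
    have h2 := fun i hi => hf i (Finset.mem_insert_of_mem hi)
    rw [Finset.sum_insert ha, Finset.sum_insert ha, Rat.cast_add_of_ne_zero
      (mem_pIntegral_iff_den_cast_ne_zero.mp h1)
      (mem_pIntegral_iff_den_cast_ne_zero.mp (sum_mem h2)), ih h2]

theorem cast_intCast_mul_inv_natCast (c : ℤ) {d : ℕ} (hd : ¬ p ∣ d) :
    (((c : ℚ) * (d : ℚ)⁻¹ : ℚ) : ZMod p) = c / (d : ZMod p) := by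
  have h1 : (((d : ℚ)⁻¹).den : ZMod p) ≠ 0 :=
    mem_pIntegral_iff_den_cast_ne_zero.mp (inv_natCast_mem_pIntegral hd)
  have h2 : ((d : ℕ) : ZMod p) ≠ 0 := by rwa [Ne, ZMod.natCast_eq_zero_iff]
  rw [Rat.cast_mul_of_ne_zero (by simp) h1, Rat.cast_inv_of_ne_zero (by simpa using h2)]
  simp [div_eq_mul_inv]

theorem mem_pMultiples_one_of_cast_eq_zero {x : ℚ} (hx : x ∈ pIntegral p)
    (h : (x : ZMod p) = 0) : x ∈ pMultiples p 1 := by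
  rw [Rat.cast_def, div_eq_zero_iff, or_iff_left (mem_pIntegral_iff_den_cast_ne_zero.mp hx),
    ZMod.intCast_zmod_eq_zero_iff_dvd] at h
  obtain ⟨c, hc⟩ := h
  refine ⟨c * (x.den : ℚ)⁻¹, mul_mem (intCast_mem _ _) (inv_natCast_mem_pIntegral hx), ?_⟩
  conv_lhs => rw [← Rat.num_div_den x, hc]
  push_cast
  ring

/-! ### Rising factorials of `p`-integral numbers -/

theorem rising_mem_pIntegral {t : ℚ} (ht : t ∈ pIntegral p) (n : ℕ) : rising t n ∈ pIntegral p :=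
  prod_mem fun j _ => add_mem ht (natCast_mem _ j)

theorem rising_mem_pMultiples {t : ℚ} (ht : t ∈ pIntegral p) {i n : ℕ} (hi : i < n)
    (h : t + i ∈ pMultiples p 1) : rising t n ∈ pMultiples p 1 := by
  rw [rising, ← Finset.prod_erase_mul _ _ (Finset.mem_range.mpr hi)]
  exact mul_mem_pMultiples (prod_mem fun j _ => add_mem ht (natCast_mem _ j)) h

theorem rising_add_one_sub_factorial_mem {t : ℚ} (ht : t ∈ pMultiples p 1) (n : ℕ) :
    rising (t + 1) n - n.factorial ∈ pMultiples p 1 := by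
  induction n with
  | zero => simp [zero_mem]
  | succ n ih =>
    have ht' := mem_pIntegral_of_mem_pMultiples ht
    have e : rising (t + 1) (n + 1) - (n + 1).factorial =
        (n + 1) * (rising (t + 1) n - n.factorial) + rising (t + 1) n * t := by
      rw [rising_succ, Nat.factorial_succ]
      push_cast
      ring
    rw [e]
    exact add_mem (mul_mem_pMultiples (add_mem (natCast_mem _ _) (one_mem _)) ih)
      (mul_mem_pMultiples (rising_mem_pIntegral (add_mem ht' (one_mem _)) n) ht)

end PIntegral

theorem poch_eq_rising (a : ℚ) (n : ℕ) : poch a n = rising a n := by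
  induction n with
  | zero => simp [poch]
  | succ n ih => rw [rising_succ, ← ih, poch, poch, ascPochhammer_succ_right]; simp

theorem rising_half_mul_four_pow (n : ℕ) :
    rising (1 / 2 : ℚ) n * 4 ^ n = n.centralBinom * n.factorial := by
  induction n with
  | zero => simp
  | succ n ih =>
    have h : ((n + 1 : ℕ) : ℚ) * (n + 1).centralBinom = 2 * (2 * n + 1) * n.centralBinom := by
      exact_mod_cast Nat.succ_mul_centralBinom_succ n
    rw [rising_succ, Nat.factorial_succ]
    push_cast at h ⊢
    linear_combination (4 * (1 / 2 + n : ℚ)) * ih - (n.factorial : ℚ) * h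

/-! ### The sums with arguments `4` and `-4` -/

section Families

variable {p : ℕ} [hp : Fact p.Prime] {m : ℕ}

theorem half_add_mem_pMultiples (hm : p = 2 * m + 1) (hp2 : 2 < p) :
    (1 / 2 + m : ℚ) ∈ pMultiples p 1 :=
  ⟨(2 : ℚ)⁻¹, inv_two_mem_pIntegral hp2, by rw [hm]; push_cast; ring⟩

theorem half_mem_pIntegral (hp2 : 2 < p) : (1 / 2 : ℚ) ∈ pIntegral p := by
  rw [one_div]
  exact inv_two_mem_pIntegral hp2

theorem rising_half_add_mem_pMultiples (hm : p = 2 * m + 1) (hp2 : 2 < p) {k : ℕ} (hk : k < m) :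
    rising (1 / 2 + k + 1 : ℚ) m ∈ pMultiples p 1 := by
  -- The factor with this index is 1/2 + m = p/2.
  refine rising_mem_pMultiples (i := m - 1 - k) ?_ (by omega) ?_
  · exact add_mem (add_mem (half_mem_pIntegral hp2) (natCast_mem _ _)) (one_mem _)
  · convert half_add_mem_pMultiples hm hp2 using 1
    rw [Nat.cast_sub (by omega), Nat.cast_sub (by omega)]
    push_cast
    ring

theorem sub_mem_pMultiples_of_steps {e : ℕ} (F : ℚ → ℚ) (t : ℚ)
    (h : ∀ k < m, F (t + k + 1) - F (t + k) ∈ pMultiples p e) :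
    F (t + m) - F t ∈ pMultiples p e := by
  induction m with
  | zero => simp [zero_mem]
  | succ m ih =>
    have h1 := add_mem (h m (by omega)) (ih fun k hk => h k (by omega))
    rw [sub_add_sub_cancel] at h1
    push_cast
    rwa [← add_assoc]

theorem sum_centralBinom_div_mem (hm : p = 2 * m + 1) :
    ∑ n ∈ Finset.range m, (3 * (n + 1).centralBinom * ((n + 1 : ℕ) : ℚ)⁻¹ : ℚ) ∈
      pMultiples p 1 := by
  have h : ∀ n ∈ Finset.range m, ¬ p ∣ n + 1 := fun n hn hd => by
    have := Nat.le_of_dvd (by omega) hd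
    have := Finset.mem_range.mp hn
    omega
  have hmem : ∀ n ∈ Finset.range m,
      (3 * (n + 1).centralBinom * ((n + 1 : ℕ) : ℚ)⁻¹ : ℚ) ∈ pIntegral p := fun n hn =>
    mul_mem (mul_mem (ofNat_mem _ 3) (natCast_mem _ _)) (inv_natCast_mem_pIntegral (h n hn))
  refine mem_pMultiples_one_of_cast_eq_zero (sum_mem hmem) ?_
  rw [cast_sum_of_mem_pIntegral _ _ hmem, ← sum_centralBinom_div_eq_zero hm]
  refine Finset.sum_congr rfl fun n hn => ?_
  have := cast_intCast_mul_inv_natCast (p := p) (3 * (n + 1).centralBinom) (h n hn)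
  push_cast at this ⊢
  exact this

theorem sum_neg_one_pow_centralBinom_div_sq_mem (hm : p = 2 * m + 1) (hp3 : 3 < p) :
    ∑ n ∈ Finset.range m,
      (10 * ((-1) ^ (n + 1) * (n + 1).centralBinom) * (((n + 1) ^ 2 : ℕ) : ℚ)⁻¹ : ℚ) ∈
        pMultiples p 1 := by
  have h : ∀ n ∈ Finset.range m, ¬ p ∣ (n + 1) ^ 2 := fun n hn hd => by
    have := Nat.le_of_dvd (by omega) (hp.out.dvd_of_dvd_pow hd)
    have := Finset.mem_range.mp hn
    omega
  have hmem : ∀ n ∈ Finset.range m,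
      (10 * ((-1) ^ (n + 1) * (n + 1).centralBinom) * (((n + 1) ^ 2 : ℕ) : ℚ)⁻¹ : ℚ) ∈
        pIntegral p := fun n hn =>
    mul_mem (mul_mem (ofNat_mem _ 10)
      (mul_mem (pow_mem (neg_mem (one_mem _)) _) (natCast_mem _ _)))
      (inv_natCast_mem_pIntegral (h n hn))
  refine mem_pMultiples_one_of_cast_eq_zero (sum_mem hmem) ?_
  rw [cast_sum_of_mem_pIntegral _ _ hmem, ← sum_neg_one_pow_centralBinom_div_sq_eq_zero hm hp3]
  refine Finset.sum_congr rfl fun n hn => ?_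
  have := cast_intCast_mul_inv_natCast (p := p)
    (10 * ((-1) ^ (n + 1) * (n + 1).centralBinom)) (h n hn)
  push_cast at this ⊢
  exact this

theorem sum_half_cubes_sub_mem (hm : p = 2 * m + 1) (hp2 : 2 < p) :
    ∑ n ∈ Finset.range (m + 1),
      poch (1 / 2) n ^ 3 / (n.factorial : ℚ) ^ 3 * (3 * (n : ℚ) + 1) * 2 ^ (2 * n) - (p : ℚ) ∈
        pMultiples p 3 := by
  set a : ℕ → ℚ := fun n => n.centralBinom / (n.factorial : ℚ) ^ 2 with ha_def
  have hfac : ∀ n : ℕ, (n.factorial : ℚ) ≠ 0 := fun n => by exact_mod_cast n.factorial_ne_zero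
  have ha : ∀ n < m, a (n + 1) * (n + 1) ^ 3 = a n * (4 * n + 2) := by
    intro n hn
    have h2 := hfac n
    have h3 : ((n + 1 : ℕ) : ℚ) * (n + 1).centralBinom = 2 * (2 * n + 1) * n.centralBinom := by
      exact_mod_cast Nat.succ_mul_centralBinom_succ n
    simp only [ha_def, Nat.factorial_succ]
    push_cast at h3 ⊢
    field_simp
    linear_combination h3
  have hpm : (p : ℚ) = 2 * m + 1 := by rw [hm]; push_cast; ring
  have ha_mem : ∀ n < p, a n ∈ pIntegral p := fun n hn => by
    rw [ha_def]
    simp only [div_eq_mul_inv, ← inv_pow]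
    exact mul_mem (natCast_mem _ _) (pow_mem (inv_factorial_mem_pIntegral hn) _)
  set F : ℚ → ℚ := fun t =>
    ∑ n ∈ Finset.range (m + 1), rising t n ^ 2 * (3 * n + 2 * t) * a n with hF
  -- Each unit step from 1/2 to p/2 contributes p² from the squared rising factorial and p from 4m +
  -- 2 = 2p.
  have h1 : F (1 / 2 + m) - F (1 / 2) ∈ pMultiples p 3 := by
    refine sub_mem_pMultiples_of_steps F _ fun k hk => ?_
    rw [hF]
    simp only
    rw [sum_rising_sq_telescope _ a m ha]
    refine mul_mem_pMultiples_add (j := 2) (k := 1)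
      (pow_mem_pMultiples (rising_half_add_mem_pMultiples hm hp2 hk) 2)
      (mul_mem_pMultiples (ha_mem m (by omega)) ⟨2, ofNat_mem _ 2, ?_⟩)
    rw [hpm]
    ring
  have h2 : F (1 / 2 + m) - p ∈ pMultiples p 3 := by
    have hh := half_add_mem_pMultiples hm hp2
    have hz := mul_mem_pMultiples_add (pow_mem_pMultiples hh 2) (sum_centralBinom_div_mem hm)
    -- The term subtracted and added is (p/2)² ∑ 3 C(2n,n)/n, the leading part of the tail, itself
    -- divisible by p³.
    rw [← sub_add_cancel (F _ - _)]
    refine add_mem ?_ hz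
    rw [hF]
    simp only
    rw [Finset.sum_range_succ']
    have e0 : rising (1 / 2 + m : ℚ) 0 ^ 2 * (3 * ((0 : ℕ) : ℚ) + 2 * (1 / 2 + m)) * a 0 = p := by
      simp [ha_def, hpm]
      ring
    rw [e0, add_sub_cancel_right, Finset.mul_sum, ← Finset.sum_sub_distrib]
    refine sum_mem fun n hn => ?_
    have hn' := Finset.mem_range.mp hn
    -- With t = p/2, a factor t² comes out; the cofactor is divisible by p since (t+1)_n ≡ n! and
    -- the linear term 2t is p.
    have e : rising (1 / 2 + m : ℚ) (n + 1) ^ 2 * (3 * ((n + 1 : ℕ) : ℚ) + 2 * (1 / 2 + m)) *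
        a (n + 1) - (1 / 2 + m) ^ 2 * (3 * (n + 1).centralBinom * ((n + 1 : ℕ) : ℚ)⁻¹) =
        (1 / 2 + m) ^ 2 * (a (n + 1) *
          (3 * ((n + 1 : ℕ) : ℚ) *
            (rising ((1 / 2 + m : ℚ) + 1) n ^ 2 - (n.factorial : ℚ) ^ 2) +
          rising ((1 / 2 + m : ℚ) + 1) n ^ 2 * (2 * (1 / 2 + m)))) := by
      have h2 := hfac n
      rw [rising_succ_left]
      simp only [ha_def, Nat.factorial_succ]
      push_cast
      field_simp
      ring
    rw [e]
    have hi := mem_pIntegral_of_mem_pMultiples hh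
    have hr := rising_mem_pIntegral (add_mem hi (one_mem _)) n
    refine mul_mem_pMultiples_add (j := 2) (k := 1) (pow_mem_pMultiples hh 2)
      (mul_mem_pMultiples (ha_mem _ (by omega)) (add_mem
        (mul_mem_pMultiples (mul_mem (ofNat_mem _ 3) (natCast_mem _ _))
          (pow_sub_pow_mem_pMultiples hr (natCast_mem _ _)
            (rising_add_one_sub_factorial_mem hh n) 2))
        (mul_mem_pMultiples (pow_mem hr 2) (mul_mem_pMultiples (ofNat_mem _ 2) hh))))
  have h3 : F (1 / 2) = ∑ n ∈ Finset.range (m + 1),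
      poch (1 / 2) n ^ 3 / (n.factorial : ℚ) ^ 3 * (3 * (n : ℚ) + 1) * 2 ^ (2 * n) := by
    refine Finset.sum_congr rfl fun n _ => ?_
    have h4 := rising_half_mul_four_pow n
    have h2 := hfac n
    rw [poch_eq_rising, pow_mul]
    simp only [ha_def]
    norm_num at h4 ⊢
    field_simp
    linear_combination (-rising (1 / 2 : ℚ) n ^ 2) * h4
  have := sub_mem h2 h1
  rwa [sub_sub_sub_cancel_left, h3] at this

theorem sum_half_fifths_sub_mem (hm : p = 2 * m + 1) (hp3 : 3 < p) :
    ∑ n ∈ Finset.range (m + 1),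
      poch (1 / 2) n ^ 5 / (n.factorial : ℚ) ^ 5 * (10 * (n : ℚ) ^ 2 + 6 * (n : ℚ) + 1) *
        (-1) ^ n * 2 ^ (2 * n) - (p : ℚ) ^ 2 ∈ pMultiples p 5 := by
  have hp2 : 2 < p := by omega
  set a : ℕ → ℚ := fun n => (-1) ^ n * n.centralBinom / (n.factorial : ℚ) ^ 4 with ha_def
  have hfac : ∀ n : ℕ, (n.factorial : ℚ) ≠ 0 := fun n => by exact_mod_cast n.factorial_ne_zero
  have ha : ∀ n < m, a (n + 1) * (n + 1) ^ 5 = -(a n * (4 * n + 2)) := by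
    intro n hn
    have h2 := hfac n
    have h3 : ((n + 1 : ℕ) : ℚ) * (n + 1).centralBinom = 2 * (2 * n + 1) * n.centralBinom := by
      exact_mod_cast Nat.succ_mul_centralBinom_succ n
    simp only [ha_def, Nat.factorial_succ, pow_succ (-1 : ℚ) n]
    push_cast at h3 ⊢
    field_simp
    linear_combination (-1) * h3
  have hpm : (p : ℚ) = 2 * m + 1 := by rw [hm]; push_cast; ring
  have ha_mem : ∀ n < p, a n ∈ pIntegral p := fun n hn => by
    rw [ha_def]
    simp only [div_eq_mul_inv, ← inv_pow]
    exact mul_mem (mul_mem (pow_mem (neg_mem (one_mem _)) _) (natCast_mem _ _))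
      (pow_mem (inv_factorial_mem_pIntegral hn) _)
  set F : ℚ → ℚ := fun t =>
    ∑ n ∈ Finset.range (m + 1), rising t n ^ 4 * (10 * (n : ℚ) ^ 2 + 12 * t * n + 4 * t ^ 2) * a n
    with hF
  have h1 : F (1 / 2 + m) - F (1 / 2) ∈ pMultiples p 5 := by
    refine sub_mem_pMultiples_of_steps F _ fun k hk => ?_
    rw [hF]
    simp only
    rw [sum_rising_pow_four_telescope _ a m ha, mul_comm (2 : ℚ), mul_assoc, mul_assoc]
    have hhalf : (2 * (m + 1 + 2 * (1 / 2 + k)) : ℚ) ∈ pIntegral p :=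
      mul_mem (ofNat_mem _ 2) (add_mem (add_mem (natCast_mem _ _) (one_mem _))
        (mul_mem (ofNat_mem _ 2) (add_mem (half_mem_pIntegral hp2) (natCast_mem _ _))))
    rw [← mul_assoc (2 : ℚ)]
    refine mul_mem_pMultiples_add (j := 4) (k := 1)
      (pow_mem_pMultiples (rising_half_add_mem_pMultiples hm hp2 hk) 4)
      (mul_mem_pMultiples hhalf
        (mul_mem_pMultiples (ha_mem m (by omega)) ⟨2, ofNat_mem _ 2, ?_⟩))
    rw [hpm]
    ring
  have h2 : F (1 / 2 + m) - (p : ℚ) ^ 2 ∈ pMultiples p 5 := by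
    have hh := half_add_mem_pMultiples hm hp2
    have hz := mul_mem_pMultiples_add (pow_mem_pMultiples hh 4)
      (sum_neg_one_pow_centralBinom_div_sq_mem hm hp3)
    -- Here the leading part of the tail is (p/2)⁴ ∑ 10 (-1)^n C(2n,n)/n².
    rw [← sub_add_cancel (F _ - _)]
    refine add_mem ?_ hz
    rw [hF]
    simp only
    rw [Finset.sum_range_succ']
    have e0 : rising (1 / 2 + m : ℚ) 0 ^ 4 * (10 * ((0 : ℕ) : ℚ) ^ 2 +
        12 * (1 / 2 + m) * ((0 : ℕ) : ℚ) + 4 * (1 / 2 + m) ^ 2) * a 0 = (p : ℚ) ^ 2 := by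
      simp [ha_def, hpm]
      ring
    rw [e0, add_sub_cancel_right, Finset.mul_sum, ← Finset.sum_sub_distrib]
    refine sum_mem fun n hn => ?_
    have hn' := Finset.mem_range.mp hn
    have e : rising (1 / 2 + m : ℚ) (n + 1) ^ 4 * (10 * ((n + 1 : ℕ) : ℚ) ^ 2 +
          12 * (1 / 2 + m) * ((n + 1 : ℕ) : ℚ) + 4 * (1 / 2 + m) ^ 2) * a (n + 1) -
        (1 / 2 + m) ^ 4 * (10 * ((-1) ^ (n + 1) * (n + 1).centralBinom) *
          (((n + 1) ^ 2 : ℕ) : ℚ)⁻¹) =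
        (1 / 2 + m) ^ 4 * (a (n + 1) *
          (10 * ((n + 1 : ℕ) : ℚ) ^ 2 *
            (rising ((1 / 2 + m : ℚ) + 1) n ^ 4 - (n.factorial : ℚ) ^ 4) +
          rising ((1 / 2 + m : ℚ) + 1) n ^ 4 *
            ((12 * ((n + 1 : ℕ) : ℚ) + 4 * (1 / 2 + m)) * (1 / 2 + m)))) := by
      have h2 := hfac n
      rw [rising_succ_left]
      simp only [ha_def, Nat.factorial_succ]
      push_cast
      field_simp
      ring
    rw [e]
    have hi := mem_pIntegral_of_mem_pMultiples hh
    have hr := rising_mem_pIntegral (add_mem hi (one_mem _)) n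
    refine mul_mem_pMultiples_add (j := 4) (k := 1) (pow_mem_pMultiples hh 4)
      (mul_mem_pMultiples (ha_mem _ (by omega)) (add_mem
        (mul_mem_pMultiples (mul_mem (ofNat_mem _ 10) (pow_mem (natCast_mem _ _) 2))
          (pow_sub_pow_mem_pMultiples hr (natCast_mem _ _)
            (rising_add_one_sub_factorial_mem hh n) 4))
        (mul_mem_pMultiples (pow_mem hr 4) (mul_mem_pMultiples
          (add_mem (mul_mem (ofNat_mem _ 12) (natCast_mem _ _)) (mul_mem (ofNat_mem _ 4) hi)) hh))))
  have h3 : F (1 / 2) = ∑ n ∈ Finset.range (m + 1),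
      poch (1 / 2) n ^ 5 / (n.factorial : ℚ) ^ 5 * (10 * (n : ℚ) ^ 2 + 6 * (n : ℚ) + 1) *
        (-1) ^ n * 2 ^ (2 * n) := by
    refine Finset.sum_congr rfl fun n _ => ?_
    have h4 := rising_half_mul_four_pow n
    have h2 := hfac n
    rw [poch_eq_rising, pow_mul]
    simp only [ha_def]
    norm_num at h4 ⊢
    field_simp
    linear_combination (-rising (1 / 2 : ℚ) n ^ 4) * h4
  have := sub_mem h2 h1
  rwa [sub_sub_sub_cancel_left, h3] at this

/-- The terms with `(p - 1) / 2 < n < p` do not affect the sums. -/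
theorem sum_range_prime_sub_mem (hm : p = 2 * m + 1) (hp2 : 2 < p) (e : ℕ) (g : ℕ → ℚ)
    (hg : ∀ n, g n ∈ pIntegral p) :
    ∑ n ∈ Finset.range (p - 1 + 1), poch (1 / 2) n ^ e / (n.factorial : ℚ) ^ e * g n -
      ∑ n ∈ Finset.range (m + 1), poch (1 / 2) n ^ e / (n.factorial : ℚ) ^ e * g n ∈
        pMultiples p e := by
  rw [← Finset.sum_range_add_sum_Ico _ (show m + 1 ≤ p - 1 + 1 by omega), add_sub_cancel_left]
  refine sum_mem fun n hn => ?_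
  obtain ⟨hn1, hn2⟩ := Finset.mem_Ico.mp hn
  rw [mul_comm, div_eq_mul_inv, mul_comm (_ ^ e), ← inv_pow, poch_eq_rising]
  exact mul_mem_pMultiples (hg n) (mul_mem_pMultiples
    (pow_mem (inv_factorial_mem_pIntegral (by omega)) _)
    (pow_mem_pMultiples (rising_mem_pMultiples (half_mem_pIntegral hp2) (i := m) (by omega)
      (half_add_mem_pMultiples hm hp2)) e))

end Families

/-! ### A terminating summation formula with argument `-8` -/

/-- The hypergeometric factor
`(1/2 + u)_n ((1 + s)/2)_n ((1 + r)/2)_n (-8)^n / (n! (1 + s)_n (1 + r)_n)`. -/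
def strangeFactor (u s r : ℚ) (n : ℕ) : ℚ :=
  ∏ i ∈ Finset.range n,
    -((1 + 2 * u + 2 * i) * ((1 + s + 2 * i) * (1 + r + 2 * i))) *
      ((1 + i) * ((1 + s + i) * (1 + r + i)))⁻¹

/-- The summand `(1 + 2 u + 3 n) (1/2 + u)_n ((1 + s)/2)_n ((1 + r)/2)_n (-8)^n /
(n! (1 + s)_n (1 + r)_n)`. -/
def strangeTerm (u s r : ℚ) (n : ℕ) : ℚ := (1 + 2 * u + 3 * n) * strangeFactor u s r n

theorem strangeFactor_succ (u s r : ℚ) (n : ℕ) :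
    strangeFactor u s r (n + 1) = strangeFactor u s r n *
      (-((1 + 2 * u + 2 * n) * ((1 + s + 2 * n) * (1 + r + 2 * n))) *
        ((1 + n) * ((1 + s + n) * (1 + r + n)))⁻¹) := by
  rw [strangeFactor, Finset.prod_range_succ, ← strangeFactor]

theorem strangeFactor_eq_zero {u s r : ℚ} {i n : ℕ} (hi : i < n)
    (h : (1 + 2 * u + 2 * i) * ((1 + s + 2 * i) * (1 + r + 2 * i)) = 0) :
    strangeFactor u s r n = 0 :=
  Finset.prod_eq_zero (Finset.mem_range.mpr hi) (by rw [h]; simp)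

/-- The change of parameters moves (1/2+u)_n and ((1+s)/2)_n by one place and (1+s)_n by two, so
only end factors survive in the quotient. -/
theorem strangeFactor_shift {u s r : ℚ} (n : ℕ) (hs : ∀ i ≤ n + 1, 1 + s + i ≠ 0) :
    strangeFactor (u + 1) (s + 2) r n * ((1 + 2 * u) * ((1 + s + n) * (2 + s + n))) =
      strangeFactor u s r n * ((1 + 2 * u + 2 * n) * ((1 + s + 2 * n) * (2 + s))) := by
  induction n with
  | zero => simp [strangeFactor]
  | succ n ih =>
    have ih := ih fun i hi => hs i (by omega)
    have h1 := hs n (by omega)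
    have h2 : 1 + (s + 2) + n ≠ 0 := by
      have := hs (n + 2) le_rfl
      push_cast at this
      intro h
      exact this (by linear_combination h)
    rw [strangeFactor_succ, strangeFactor_succ]
    push_cast
    simp only [mul_inv]
    generalize (1 + (n : ℚ))⁻¹ = x
    generalize (1 + r + (n : ℚ))⁻¹ = y
    field_simp
    linear_combination (-x * y * (1 + 2 * (u + 1) + 2 * n) * (1 + (s + 2) + 2 * n) *
      (1 + r + 2 * n) * (1 + (s + 2) + n)) * ih

/-- A contiguous relation with explicit certificate N(N+r)/(N+1+s). When the series terminates
before N the right side is 0, so the sums at (u, s) and (u + 1, s + 2) are proportional. -/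
theorem sum_strangeTerm_telescope {u s r : ℚ} (hu : 2 * u = s + r) (N : ℕ)
    (hs : ∀ i ≤ N, 1 + s + i ≠ 0) (hr : ∀ i < N, 1 + r + i ≠ 0) (hu0 : 1 + 2 * u ≠ 0)
    (hs2 : 2 + s ≠ 0) :
    (1 + 2 * u) / (2 + s) * ∑ n ∈ Finset.range N, strangeTerm (u + 1) (s + 2) r n -
      ∑ n ∈ Finset.range N, strangeTerm u s r n =
    -(strangeFactor u s r N * (N * (N + r) / (N + 1 + s))) := by
  obtain rfl : s = 2 * u - r := by linear_combination -hu
  induction N with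
  | zero => simp
  | succ N ih =>
    have ih := ih (fun i hi => hr i (by omega)) (fun i hi => hs i (by omega))
    have h1 := hs N (by omega)
    have h2 := hs (N + 1) le_rfl
    have h3 := hr N (by omega)
    have h4 := strangeFactor_shift (u := u) (r := r) N hs
    have h5 : (1 + N : ℚ) ≠ 0 := by positivity
    push_cast at h2
    have h6 : (N + 1 + (2 * u - r) : ℚ) ≠ 0 := fun h => h1 (by linear_combination h)
    have h7 : (N + 1 + 1 + (2 * u - r) : ℚ) ≠ 0 := fun h => h2 (by linear_combination h)
    have h8 : (2 + (2 * u - r) + N : ℚ) ≠ 0 := fun h => h2 (by linear_combination h)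
    have h9 : strangeFactor (u + 1) (2 * u - r + 2) r N = strangeFactor u (2 * u - r) r N *
        ((1 + 2 * u + 2 * N) * ((1 + (2 * u - r) + 2 * N) * (2 + (2 * u - r)))) /
          ((1 + 2 * u) * ((1 + (2 * u - r) + N) * (2 + (2 * u - r) + N))) := by
      rw [eq_div_iff (mul_ne_zero hu0 (mul_ne_zero h1 h8)), h4]
    rw [Finset.sum_range_succ, Finset.sum_range_succ, mul_add, add_sub_add_comm, ih, strangeTerm,
      strangeTerm, h9, strangeFactor_succ]
    generalize strangeFactor u (2 * u - r) r N = x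
    push_cast
    field_simp
    ring

/-- The sum of the terminating series with `u = -1/2 - M` vanishes. -/
theorem sum_strangeTerm_eq_zero (M : ℕ) {u s r : ℚ} (hM : u = -1 / 2 - M) (hu : 2 * u = s + r)
    (hs : ∀ i : ℕ, 1 + s + i ≠ 0) (hr : ∀ i : ℕ, 1 + r + i ≠ 0) :
    ∑ n ∈ Finset.range (M + 1), strangeTerm u s r n = 0 := by
  induction M generalizing u s with
  | zero =>
    simp [strangeTerm, hM]
    norm_num
  | succ M ih =>
    have hs2 : 2 + s ≠ 0 := by
      have := hs 1
      push_cast at this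
      intro h
      exact this (by linear_combination h)
    have hu0 : 1 + 2 * u ≠ 0 := by
      rw [hM]
      push_cast
      intro h
      have : (M : ℚ) + 1 = 0 := by linear_combination (-1 / 2) * h
      exact absurd this (by positivity)
    have key := sum_strangeTerm_telescope hu (M + 1 + 1) (fun i _ => hs i) (fun i _ => hr i)
      hu0 hs2
    have hM' : u + 1 = -1 / 2 - M := by rw [hM]; push_cast; ring
    -- The factor 1 + 2u + 2i vanishes at i = M + 1, and for u + 1 already at i = M; this removes
    -- the boundary term and the surplus last term.
    rw [strangeFactor_eq_zero (u := u) (i := M + 1) (by omega) (by rw [hM]; push_cast; ring),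
      Finset.sum_range_succ, ih hM' (by linear_combination hu) (fun i h => hs (i + 2) (by
        push_cast
        linear_combination h)), strangeTerm,
      strangeFactor_eq_zero (u := u + 1) (i := M) (by omega) (by rw [hM']; ring)] at key
    linear_combination -key

/-- The sum of the terminating series with `s = -(2 M + 1)`. -/
theorem sum_strangeTerm_mul_prod (M : ℕ) {u s r : ℚ} (hu0 : 0 ≤ u) (hs : s = -(2 * M + 1))
    (hu : 2 * u = s + r) :
    (∑ n ∈ Finset.range (M + 1), strangeTerm u s r n) * ∏ j ∈ Finset.range M, (2 * j + 1 : ℚ) =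
      (-1) ^ M * ∏ j ∈ Finset.range (M + 1), (1 + 2 * u + 2 * j) := by
  induction M generalizing u s with
  | zero => simp [strangeTerm, strangeFactor]
  | succ M ih =>
    have hr : ∀ i : ℕ, 1 + r + i ≠ 0 := fun i => by
      have : r = 2 * u + 2 * (M + 1 : ℕ) + 1 := by linear_combination -hu - hs
      rw [this]
      positivity
    have hu1 : 1 + 2 * u ≠ 0 := by positivity
    have hcast : (s + 2 : ℚ) = -(2 * M + 1) := by rw [hs]; push_cast; ring
    have hM0 : (2 * M + 1 : ℚ) ≠ 0 := by positivity
    have hs2 : 2 + s ≠ 0 := by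
      rw [add_comm, hcast]
      exact neg_ne_zero.mpr hM0
    have ih := ih (u := u + 1) (by linarith) hcast (by linear_combination hu)
    have step : ∑ n ∈ Finset.range (M + 1 + 1), strangeTerm u s r n =
        (1 + 2 * u) / (2 + s) * ∑ n ∈ Finset.range (M + 1), strangeTerm (u + 1) (s + 2) r n := by
      -- The denominator 1 + s + i vanishes at i = 2M + 2, which the telescoping up to M + 2 avoids
      -- only for M > 0; the case M = 0 is computed directly.
      rcases Nat.eq_zero_or_pos M with rfl | hM
      · obtain rfl : r = 2 * u + 3 := by rw [hs] at hu; push_cast at hu; linear_combination -hu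
        have := hr 0
        push_cast at this hs
        subst hs
        simp [Finset.sum_range_succ, strangeTerm, strangeFactor]
        field_simp
        ring
      · have key := sum_strangeTerm_telescope hu (M + 1 + 1) (fun i hi h => by
          rw [hs] at h
          have h' : (i : ℚ) = (2 * (M + 1) : ℕ) := by push_cast at h ⊢; linear_combination h
          have := Nat.cast_injective h'
          omega) (fun i _ => hr i) hu1 hs2
        rw [strangeFactor_eq_zero (u := u) (i := M + 1) (by omega) (by rw [hs]; push_cast; ring),
          Finset.sum_range_succ _ (M + 1), strangeTerm,
          strangeFactor_eq_zero (u := u + 1) (i := M) (by omega) (by rw [hcast]; ring)] at key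
        linear_combination -key
    rw [step, Finset.prod_range_succ, Finset.prod_range_succ' _ (M + 1)]
    have e : ∏ j ∈ Finset.range (M + 1), (1 + 2 * u + 2 * ((j + 1 : ℕ) : ℚ)) =
        ∏ j ∈ Finset.range (M + 1), (1 + 2 * (u + 1) + 2 * (j : ℚ)) :=
      Finset.prod_congr rfl fun j _ => by push_cast; ring
    rw [e, pow_succ, show 2 + s = -(2 * M + 1 : ℚ) by linear_combination hcast]
    field_simp
    push_cast
    linear_combination (-(1 + 2 * u)) * ih

theorem sum_strangeTerm_zero_neg (M : ℕ) :
    ∑ n ∈ Finset.range (M + 1), strangeTerm 0 (-(2 * M + 1)) (2 * M + 1) n =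
      (-1) ^ M * (2 * M + 1) := by
  have h := sum_strangeTerm_mul_prod M (u := 0) (r := 2 * M + 1) le_rfl rfl (by ring)
  have h0 : ∏ j ∈ Finset.range M, (2 * j + 1 : ℚ) ≠ 0 :=
    Finset.prod_ne_zero_iff.mpr fun j _ => by positivity
  refine mul_right_cancel₀ h0 (h.trans ?_)
  rw [Finset.prod_range_succ, mul_assoc, mul_comm (∏ j ∈ Finset.range M, _)]
  simp [add_comm]

/-! ### Mixed differences -/

section Grid

variable (p : ℕ) [hp : Fact p.Prime]

/-- The `p`-integral functions on a `2 × 2` grid whose first differences are divisible by `p` and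
`p ^ 2` in the two directions and whose mixed difference is divisible by `p ^ 3`. -/
def mixedDifference : Subring (Bool → Bool → ℚ) where
  carrier := {g | ∃ a ∈ pIntegral p, ∃ b ∈ pIntegral p, ∃ c ∈ pIntegral p, ∃ d ∈ pIntegral p,
    g false false = a ∧ g true false = a + p * b ∧ g false true = a + p * (p * c) ∧
      g true true = a + p * (b + p * c + p ^ 2 * d)}
  mul_mem' := by
    rintro f g ⟨a, ha, b, hb, c, hc, d, hd, h1, h2, h3, h4⟩
      ⟨a', ha', b', hb', c', hc', d', hd', h1', h2', h3', h4'⟩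
    have hp := natCast_mem (pIntegral p) p
    refine ⟨a * a', mul_mem ha ha', a * b' + b * a' + p * (b * b'),
      add_mem (add_mem (mul_mem ha hb') (mul_mem hb ha')) (mul_mem hp (mul_mem hb hb')),
      a * c' + c * a' + p ^ 2 * (c * c'),
      add_mem (add_mem (mul_mem ha hc') (mul_mem hc ha')) (mul_mem (pow_mem hp 2) (mul_mem hc hc')),
      a * d' + d * a' + b * c' + c * b' + p * (b * d' + d * b') + p ^ 2 * (c * d' + d * c') +
        p ^ 3 * (d * d'),
      ?_, ?_, ?_, ?_, ?_⟩
    · refine add_mem (add_mem (add_mem (add_mem (add_mem (add_mem ?_ ?_) ?_) ?_) ?_) ?_) ?_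
      · exact mul_mem ha hd'
      · exact mul_mem hd ha'
      · exact mul_mem hb hc'
      · exact mul_mem hc hb'
      · exact mul_mem hp (add_mem (mul_mem hb hd') (mul_mem hd hb'))
      · exact mul_mem (pow_mem hp 2) (add_mem (mul_mem hc hd') (mul_mem hd hc'))
      · exact mul_mem (pow_mem hp 3) (mul_mem hd hd')
    · simp [h1, h1']
    · simp [h2, h2']; ring
    · simp [h3, h3']; ring
    · simp [h4, h4']; ring
  one_mem' := ⟨1, one_mem _, 0, zero_mem _, 0, zero_mem _, 0, zero_mem _, by simp⟩
  add_mem' := by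
    rintro f g ⟨a, ha, b, hb, c, hc, d, hd, h1, h2, h3, h4⟩
      ⟨a', ha', b', hb', c', hc', d', hd', h1', h2', h3', h4'⟩
    refine ⟨a + a', add_mem ha ha', b + b', add_mem hb hb', c + c', add_mem hc hc', d + d',
      add_mem hd hd', ?_, ?_, ?_, ?_⟩
    · simp [h1, h1']
    · simp [h2, h2']; ring
    · simp [h3, h3']; ring
    · simp [h4, h4']; ring
  zero_mem' := ⟨0, zero_mem _, 0, zero_mem _, 0, zero_mem _, 0, zero_mem _, by simp⟩
  neg_mem' := by
    rintro f ⟨a, ha, b, hb, c, hc, d, hd, h1, h2, h3, h4⟩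
    refine ⟨-a, neg_mem ha, -b, neg_mem hb, -c, neg_mem hc, -d, neg_mem hd, ?_, ?_, ?_, ?_⟩
    · simp [h1]
    · simp [h2]; ring
    · simp [h3]; ring
    · simp [h4]; ring

variable {p}

theorem add_mul_ne_zero {a x : ℚ} (ha0 : a ≠ 0) (ha : a⁻¹ ∈ pIntegral p) (hx : x ∈ pIntegral p) :
    a + p * x ≠ 0 := by
  intro h
  have h1 : (1 : ℚ) = p * (-(x * a⁻¹)) := by
    field_simp
    linear_combination h
  have h2 : (p : ℚ)⁻¹ ∈ pIntegral p := by
    rw [inv_eq_of_mul_eq_one_right h1.symm]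
    exact neg_mem (mul_mem hx ha)
  change ¬ p ∣ (p : ℚ)⁻¹.den at h2
  rw [Rat.inv_natCast_den, if_neg hp.out.ne_zero] at h2
  exact h2 dvd_rfl

/-- The ring is closed under inverting g when its value at the base corner is a p-unit: all corners
agree mod p, so all are p-units. This admits the denominators of the hypergeometric terms. -/
theorem inv_mem_mixedDifference {g : Bool → Bool → ℚ} (hg : g ∈ mixedDifference p)
    (h0 : g false false ≠ 0) (hinv : (g false false)⁻¹ ∈ pIntegral p) :
    g⁻¹ ∈ mixedDifference p := by
  obtain ⟨a, ha, b, hb, c, hc, d, hd, h1, h2, h3, h4⟩ := hg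
  rw [h1] at h0 hinv
  have hp := natCast_mem (pIntegral p) p
  have hc' := mul_mem hp hc
  have hd' := add_mem (add_mem hb hc') (mul_mem (pow_mem hp 2) hd)
  have nb := add_mul_ne_zero h0 hinv hb
  have nc := add_mul_ne_zero h0 hinv hc'
  have nd := add_mul_ne_zero h0 hinv hd'
  have nc' : a + p ^ 2 * c ≠ 0 := by rwa [pow_two, mul_assoc]
  have ib := inv_add_mem_pIntegral hinv h0 hb
  have ic := inv_add_mem_pIntegral hinv h0 hc'
  have id := inv_add_mem_pIntegral hinv h0 hd'
  refine ⟨a⁻¹, hinv, -b * a⁻¹ * (a + p * b)⁻¹, mul_mem (mul_mem (neg_mem hb) hinv) ib,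
    -c * a⁻¹ * (a + p * (p * c))⁻¹, mul_mem (mul_mem (neg_mem hc) hinv) ic,
    (b * (a * (c + p * d) + c * (a + p * (b + p * c + p ^ 2 * d))) - d * a * (a + p * b)) *
      a⁻¹ * (a + p * b)⁻¹ * (a + p * (p * c))⁻¹ * (a + p * (b + p * c + p ^ 2 * d))⁻¹,
    ?_, ?_, ?_, ?_, ?_⟩
  · refine mul_mem (mul_mem (mul_mem (mul_mem (sub_mem (mul_mem hb (add_mem ?_ ?_)) ?_) hinv) ib)
      ic) id
    · exact mul_mem ha (add_mem hc (mul_mem hp hd))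
    · exact mul_mem hc (add_mem ha (mul_mem hp hd'))
    · exact mul_mem (mul_mem hd ha) (add_mem ha (mul_mem hp hb))
  · simp [h1]
  · simp only [Pi.inv_apply, h2]
    field_simp
    ring
  · simp only [Pi.inv_apply, h3]
    field_simp
    ring
  · simp only [Pi.inv_apply, h4]
    field_simp
    ring

theorem mixed_difference_mem_pMultiples {g : Bool → Bool → ℚ} (hg : g ∈ mixedDifference p) :
    g false false - g true false - g false true + g true true ∈ pMultiples p 3 := by
  obtain ⟨a, ha, b, hb, c, hc, d, hd, h1, h2, h3, h4⟩ := hg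
  exact ⟨d, hd, by rw [h1, h2, h3, h4]; ring⟩

theorem fst_mem_mixedDifference {a b : ℚ} (ha : a ∈ pIntegral p) (hb : b ∈ pIntegral p) :
    (fun x _ => cond x (a + p * b) a) ∈ mixedDifference p :=
  ⟨a, ha, b, hb, 0, zero_mem _, 0, zero_mem _, by simp⟩

theorem snd_mem_mixedDifference {c : ℚ} (hc : c ∈ pIntegral p) :
    (fun _ y => cond y (p * (p * c)) 0) ∈ mixedDifference p :=
  ⟨0, zero_mem _, 0, zero_mem _, c, hc, 0, zero_mem _, by simp⟩

theorem const_mem_mixedDifference {a : ℚ} (ha : a ∈ pIntegral p) :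
    (fun _ _ => a) ∈ mixedDifference p :=
  ⟨a, ha, 0, zero_mem _, 0, zero_mem _, 0, zero_mem _, by simp⟩

end Grid

/-! ### The sum with argument -8 -/

section NegEight

variable {p : ℕ} [hp : Fact p.Prime] {m : ℕ}

/-- The parameters s and r enter through products (c + x - y)(c + x + y) = (c + x)² - y², so the
second direction has increment p² rather than p. The denominators are p-units because n ≤ m < p. -/
theorem strangeTerm_mem_mixedDifference (hm : p = 2 * m + 1) (hp2 : 2 < p) {n : ℕ}
    (hn : n ≤ m) :
    (fun x y => strangeTerm (cond x (-(p / 2) : ℚ) 0) (cond x (-(p / 2) : ℚ) 0 - cond y (p : ℚ) 0)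
      (cond x (-(p / 2) : ℚ) 0 + cond y (p : ℚ) 0) n) ∈ mixedDifference p := by
  set U : Bool → Bool → ℚ := fun x _ => cond x (0 + p * (-(2 : ℚ)⁻¹)) 0 with hU
  set V : Bool → Bool → ℚ := fun _ y => cond y (p * (p * (1 : ℚ))) 0 with hV
  have hUm : U ∈ mixedDifference p :=
    fst_mem_mixedDifference (zero_mem _) (neg_mem (inv_two_mem_pIntegral hp2))
  have hVm : V ∈ mixedDifference p := snd_mem_mixedDifference (one_mem _)
  have e : (fun x y => strangeTerm (cond x (-(p / 2) : ℚ) 0) (cond x (-(p / 2) : ℚ) 0 - cond y (p : ℚ) 0)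
      (cond x (-(p / 2) : ℚ) 0 + cond y (p : ℚ) 0) n) =
      (1 + 2 * U + 3 * (n : Bool → Bool → ℚ)) * ∏ i ∈ Finset.range n,
        (-((1 + 2 * U + 2 * (i : Bool → Bool → ℚ)) *
          ((1 + U + 2 * (i : Bool → Bool → ℚ)) ^ 2 - V)) *
          ((fun _ _ => ((i + 1 : ℕ) : ℚ)⁻¹) *
            ((1 + U + (i : Bool → Bool → ℚ)) ^ 2 - V)⁻¹)) := by
    funext x y
    simp only [strangeTerm, strangeFactor, Pi.mul_apply, Pi.add_apply, Finset.prod_apply,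
      Pi.neg_apply, Pi.sub_apply, Pi.pow_apply, Pi.inv_apply, Pi.natCast_apply,
      Pi.ofNat_apply, hU, hV]
    have hu : cond x (-((p : ℚ) / 2)) 0 = cond x (0 + p * (-(2 : ℚ)⁻¹)) 0 := by
      cases x
      · rfl
      · simp; ring
    have hv : cond y ((p : ℚ) * (p * 1)) 0 = cond y (p : ℚ) 0 ^ 2 := by
      cases y <;> simp; ring
    rw [hu, hv]
    congr 1
    refine Finset.prod_congr rfl fun i _ => ?_
    rw [← mul_inv]
    push_cast
    congr 1
    · ring
    · congr 1
      ring
  rw [e]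
  refine mul_mem (add_mem (add_mem (one_mem _) (mul_mem (ofNat_mem _ 2) hUm))
    (mul_mem (ofNat_mem _ 3) (natCast_mem _ n))) (prod_mem fun i hi => ?_)
  have hi' := Finset.mem_range.mp hi
  have h1 : ((i + 1 : ℕ) : ℚ)⁻¹ ∈ pIntegral p :=
    inv_natCast_mem_pIntegral_of_lt (by omega) (by omega)
  refine mul_mem (neg_mem (mul_mem ?_ ?_)) (mul_mem (const_mem_mixedDifference h1) ?_)
  · exact add_mem (add_mem (one_mem _) (mul_mem (ofNat_mem _ 2) hUm))
      (mul_mem (ofNat_mem _ 2) (natCast_mem _ i))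
  · exact sub_mem (pow_mem (add_mem (add_mem (one_mem _) hUm)
      (mul_mem (ofNat_mem _ 2) (natCast_mem _ i))) 2) hVm
  · have h00 : ((1 + U + (i : Bool → Bool → ℚ)) ^ 2 - V : Bool → Bool → ℚ) false false =
        ((i + 1 : ℕ) : ℚ) ^ 2 := by
      simp [hU, hV]
      ring
    refine inv_mem_mixedDifference
      (sub_mem (pow_mem (add_mem (add_mem (one_mem _) hUm) (natCast_mem _ i)) 2) hVm) ?_ ?_
    · rw [h00]
      positivity
    · rw [h00, ← inv_pow]
      exact pow_mem h1 2

theorem half_add_intCast_add_ne_zero (k : ℤ) (i : ℕ) : (1 + (1 / 2 + k) + i : ℚ) ≠ 0 := by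
  intro h
  have h1 : ((2 * k + 2 * i + 3 : ℤ) : ℚ) = 0 := by
    push_cast
    linear_combination 2 * h
  have h2 : (2 * k + 2 * i + 3 : ℤ) = 0 := by exact_mod_cast h1
  omega

theorem strangeFactor_zero (n : ℕ) :
    strangeFactor 0 0 0 n = rising (1 / 2 : ℚ) n ^ 3 / (n.factorial : ℚ) ^ 3 * (-8) ^ n := by
  induction n with
  | zero => simp [strangeFactor]
  | succ n ih =>
    have := n.factorial_ne_zero
    rw [strangeFactor_succ, ih, rising_succ, Nat.factorial_succ]
    push_cast
    field_simp
    ring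

theorem sum_half_cubes_neg_eight_sub_mem (hm : p = 2 * m + 1) (hp2 : 2 < p) :
    ∑ n ∈ Finset.range (m + 1),
      poch (1 / 2) n ^ 3 / (n.factorial : ℚ) ^ 3 * (3 * (n : ℚ) + 1) * (-1) ^ n * 2 ^ (3 * n) -
        (-1) ^ m * (p : ℚ) ∈ pMultiples p 3 := by
  have hpm : (p : ℚ) = 2 * m + 1 := by rw [hm]; push_cast; ring
  -- Of the four corner sums, the one at the origin is the sum wanted and the other three are known
  -- exactly.
  have key := mixed_difference_mem_pMultiples
    (sum_mem fun n (hn : n ∈ Finset.range (m + 1)) =>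
      strangeTerm_mem_mixedDifference hm hp2 (Nat.lt_succ_iff.mp (Finset.mem_range.mp hn)))
  simp only [Finset.sum_apply, cond_true, cond_false, sub_zero, add_zero, zero_sub, zero_add] at key
  have hu : (-(p / 2) : ℚ) = -1 / 2 - m := by rw [hpm]; ring
  have h1 : ∑ n ∈ Finset.range (m + 1), strangeTerm (-(p / 2)) (-(p / 2)) (-(p / 2)) n = 0 := by
    -- Since p is odd, -p/2 is a half-integer and the denominators cannot vanish.
    have h : ∀ i : ℕ, 1 + (-(p / 2) : ℚ) + i ≠ 0 := fun i => by
      convert half_add_intCast_add_ne_zero (-m - 1) i using 2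
      rw [hpm]
      push_cast
      ring
    exact sum_strangeTerm_eq_zero m hu (by ring) h h
  have h2 : ∑ n ∈ Finset.range (m + 1),
      strangeTerm (-(p / 2)) (-(p / 2) - p) (-(p / 2) + p) n = 0 := by
    refine sum_strangeTerm_eq_zero m hu (by ring) (fun i => ?_) (fun i => ?_)
    · convert half_add_intCast_add_ne_zero (-3 * m - 2) i using 2
      rw [hpm]
      push_cast
      ring
    · convert half_add_intCast_add_ne_zero m i using 2
      rw [hpm]
      push_cast
      ring
  have h3 := sum_strangeTerm_zero_neg m
  rw [← hpm] at h3
  rw [h1, h2, h3, sub_zero, add_zero] at key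
  convert key using 2
  refine Finset.sum_congr rfl fun n _ => ?_
  rw [strangeTerm, neg_zero, strangeFactor_zero, poch_eq_rising, pow_mul, mul_assoc, ← mul_pow]
  norm_num
  ring

end NegEight

/-! ### Assembly of the congruences -/

theorem mainTheorem1 (p : ℕ) (hp : p.Prime) :
    (2 < p →
      RatModEq p 3
        (∑ n ∈ Finset.range ((p - 1) / 2 + 1),
          poch (1 / 2) n ^ 3 / (n.factorial : ℚ) ^ 3 * (3 * (n : ℚ) + 1) * 2 ^ (2 * n))
        (p : ℚ) ∧
      RatModEq p 3
        (∑ n ∈ Finset.range ((p - 1) + 1),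
          poch (1 / 2) n ^ 3 / (n.factorial : ℚ) ^ 3 * (3 * (n : ℚ) + 1) * 2 ^ (2 * n))
        (p : ℚ)) ∧
    (3 < p →
      RatModEq p 5
        (∑ n ∈ Finset.range ((p - 1) / 2 + 1),
          poch (1 / 2) n ^ 5 / (n.factorial : ℚ) ^ 5 *
            (10 * (n : ℚ) ^ 2 + 6 * (n : ℚ) + 1) * (-1) ^ n * 2 ^ (2 * n))
        ((p : ℚ) ^ 2) ∧
      RatModEq p 5
        (∑ n ∈ Finset.range ((p - 1) + 1),
          poch (1 / 2) n ^ 5 / (n.factorial : ℚ) ^ 5 *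
            (10 * (n : ℚ) ^ 2 + 6 * (n : ℚ) + 1) * (-1) ^ n * 2 ^ (2 * n))
        ((p : ℚ) ^ 2)) ∧
    (2 < p →
      RatModEq p 3
        (∑ n ∈ Finset.range ((p - 1) + 1),
          poch (1 / 2) n ^ 3 / (n.factorial : ℚ) ^ 3 * (3 * (n : ℚ) + 1) *
            (-1) ^ n * 2 ^ (3 * n))
        ((-1) ^ ((p - 1) / 2) * (p : ℚ))) := by
  have : Fact p.Prime := ⟨hp⟩
  have hm : 2 < p → p = 2 * ((p - 1) / 2) + 1 := fun h => by
    obtain ⟨k, hk⟩ := hp.odd_of_ne_two (by omega)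
    omega
  simp only [ratModEq_iff]
  have extend : ∀ {e : ℕ} {S T a : ℚ}, T - S ∈ pMultiples p e → S - a ∈ pMultiples p e →
      T - a ∈ pMultiples p e := fun h1 h2 => by
    have := add_mem h1 h2
    rwa [sub_add_sub_cancel] at this
  refine ⟨fun h => ?_, fun h => ?_, fun h => ?_⟩
  · have h1 := sum_half_cubes_sub_mem (hm h) h
    refine ⟨h1, extend ?_ h1⟩
    have := sum_range_prime_sub_mem (hm h) h 3 (fun n => (3 * (n : ℚ) + 1) * 2 ^ (2 * n))
      fun n => by exact_mod_cast natCast_mem (pIntegral p) ((3 * n + 1) * 2 ^ (2 * n))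
    simpa only [mul_assoc] using this
  · have h1 := sum_half_fifths_sub_mem (hm (by omega)) h
    refine ⟨h1, extend ?_ h1⟩
    have := sum_range_prime_sub_mem (hm (by omega)) (by omega) 5
      (fun n => (10 * (n : ℚ) ^ 2 + 6 * (n : ℚ) + 1) * ((-1) ^ n * 2 ^ (2 * n)))
      fun n => mul_mem (add_mem (add_mem (mul_mem (ofNat_mem _ 10) (pow_mem (natCast_mem _ _) _))
        (mul_mem (ofNat_mem _ 6) (natCast_mem _ _))) (one_mem _))
        (mul_mem (pow_mem (neg_mem (one_mem _)) _) (pow_mem (ofNat_mem _ 2) _))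
    simpa only [mul_assoc] using this
  · refine extend ?_ (sum_half_cubes_neg_eight_sub_mem (hm h) h)
    have := sum_range_prime_sub_mem (hm h) h 3
      (fun n => (3 * (n : ℚ) + 1) * ((-1) ^ n * 2 ^ (3 * n)))
      fun n => by
        exact_mod_cast intCast_mem (pIntegral p) ((3 * (n : ℤ) + 1) * ((-1) ^ n * 2 ^ (3 * n)))
    simpa only [mul_assoc] using this
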